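/- Setting. Let $n\ge 1$, let $X\in\mathbb R^{n\times p}$ be a fixed design of rank $q$, let $B^*\in\mathbb R^{p\times m}$ and $C^*\in\mathbb R^{n\times m}$ be fixed, and let $Y=XB^*+C^*+\mathcal E$, where $\mathcal E$ is a random $n\times m$ matrix that is sub-Gaussian with scale $\sigma>0$: for every $A\in\mathbb R^{n\times m}$ and $t\in\mathbb R$, $E\exp(t\langle\mathcal E,A\rangle)\le\exp(\sigma^2\|A\|_F^2t^2/2)$ (for example, $\mathcal E$ has i.i.d. $N(0,\sigma^2)$ entries). Write $\|C\|_{2,1}$ for the sum of the Euclidean norms of the rows $c_i$ of $C$, $\|C_{\mathcal J}\|_{2,1}=\sum_{i\in\mathcal J}\|c_i\|_2$, $\mathcal J^*=\{i: c^*_i\ne 0\}$ and $r^*=\mathrm{rank}(B^*)$. Theorem. For every $\vartheta>0$ there are constants $A_0,c>0$, depending on $\vartheta$ only, such that the following holds for all $A\ge A_0$. Let $r\ge r^*\ge 1$, $\lambda=A\sigma(m+\log n)^{1/2}$, $\zeta\ge 0$, and let $(\hat B,\hat C)$ be (a measurable choice of) a global minimizer of $$\tfrac12\|Y-XB-C\|_F^2+\lambda\|C\|_{2,1}\quad\text{subject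 to}\quad \mathrm{rank}(B)\le r .$$ Let $S$ be a set of pairs $(B',C')\in\mathbb R^{p\times m}\times\mathbb R^{n\times m}$ such that $$(1+\vartheta)\lambda\|C'_{\mathcal J^*}\|_{2,1}+n\|B'\|_F^2\le \lambda\|C'_{\mathcal J^{*c}}\|_{2,1}+\sigma\zeta\{(m+q)r\}^{1/2}\|XB'+C'\|_F$$ for all $(B',C')\in S$ with $\mathrm{rank}(B')\le 2r$, and such that $\{(\hat B-B^*,\hat C-C^*)\in S\}$ is an event. Then $$E\Big(\|\hat B-B^*\|_F^2\;1_{\{(\hat B-B^*,\,\hat C-C^*)\in S\}}\Big)\le c\,\sigma^2(1+\zeta^2)\frac{(m+q)r}{n}.$$ In particular, if $(\hat B-B^*,\hat C-C^*)\in S$ almost surely, then $\|\hat B-B^*\|_F^2$ is integrable and $$E\big(\|\hat B-B^*\|_F^2\big)\le c\,\sigma^2(1+\zeta^2)\frac{(m+q)r}{n}.$$ -/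

import Mathlib

open MeasureTheory ProbabilityTheory
open scoped NNReal Matrix.Norms.Frobenius

-- Throughout, `‖A‖` for a real matrix `A` is the Frobenius norm.

namespace RobustRRR

/-- `‖A_J‖_{2,1} = ∑_{i ∈ J} ‖a_i‖₂`, where `a_i` are the rows of `A`. -/
noncomputable def norm21On {n m : ℕ} (A : Matrix (Fin n) (Fin m) ℝ) (J : Finset (Fin n)) : ℝ :=
  ∑ i ∈ J, ‖WithLp.toLp 2 (A i)‖

/-- `‖A‖_{2,1}`, the sum of the Euclidean norms of all the rows of `A`. -/
noncomputable def norm21 {n m : ℕ} (A : Matrix (Fin n) (Fin m) ℝ) : ℝ :=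
  norm21On A Finset.univ

open Classical in
/-- `𝒥(C)`, the set of the indices of the nonzero rows of `C`. -/
noncomputable def rowSupport {n m : ℕ} (C : Matrix (Fin n) (Fin m) ℝ) : Finset (Fin n) :=
  Finset.univ.filter fun i => C i ≠ 0

/-- The group-`ℓ₁` penalized least squares criterion
`‖Y - X B - C‖_F² / 2 + lam ‖C‖_{2,1}`. -/
noncomputable def criterion {n p m : ℕ} (X : Matrix (Fin n) (Fin p) ℝ)
    (Y : Matrix (Fin n) (Fin m) ℝ) (lam : ℝ)
    (B : Matrix (Fin p) (Fin m) ℝ) (C : Matrix (Fin n) (Fin m) ℝ) : ℝ :=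
  ‖Y - X * B - C‖ ^ 2 / 2 + lam * norm21 C

/-- `(B, C)` is a global minimizer of the criterion subject to `rank B ≤ r`. -/
def IsEstimate {n p m : ℕ} (X : Matrix (Fin n) (Fin p) ℝ)
    (Y : Matrix (Fin n) (Fin m) ℝ) (lam : ℝ) (r : ℕ)
    (B : Matrix (Fin p) (Fin m) ℝ) (C : Matrix (Fin n) (Fin m) ℝ) : Prop :=
  B.rank ≤ r ∧
    ∀ (B' : Matrix (Fin p) (Fin m) ℝ) (C' : Matrix (Fin n) (Fin m) ℝ),
      B'.rank ≤ r → criterion X Y lam B C ≤ criterion X Y lam B' C'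

/-- The tuning parameter `lam = A σ (m + log n)^{1/2}`. -/
noncomputable def tuning (n m : ℕ) (A σ : ℝ) : ℝ :=
  A * σ * Real.sqrt ((m : ℝ) + Real.log n)

/-- The regularity inequality for `X` at one pair `(B', C')`:
`(1 + ϑ) lam ‖C'_J‖_{2,1} + n ‖B'‖_F²
  ≤ lam ‖C'_{Jᶜ}‖_{2,1} + σ ζ {(m + q) r}^{1/2} ‖X B' + C'‖_F`, where `q = rank X`. -/
def RegularAt {n p m : ℕ} (X : Matrix (Fin n) (Fin p) ℝ) (J : Finset (Fin n))
    (r : ℕ) (lam σ ϑ ζ : ℝ)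
    (B' : Matrix (Fin p) (Fin m) ℝ) (C' : Matrix (Fin n) (Fin m) ℝ) : Prop :=
  (1 + ϑ) * lam * norm21On C' J + n * ‖B'‖ ^ 2 ≤
    lam * norm21On C' Jᶜ
      + σ * ζ * Real.sqrt (((m : ℝ) + X.rank) * r) * ‖X * B' + C'‖

/-- Sub-Gaussian noise matrix of scale `σ`: every marginal `⟨E, A⟩ = ∑ᵢⱼ Eᵢⱼ Aᵢⱼ` is
sub-Gaussian with variance proxy `σ² ‖A‖_F²`. -/
def IsSubGaussianNoise {n m : ℕ} {Ω : Type*} [MeasurableSpace Ω] (P : Measure Ω)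
    (E : Ω → Matrix (Fin n) (Fin m) ℝ) (σ : ℝ) : Prop :=
  ∀ A : Matrix (Fin n) (Fin m) ℝ,
    HasSubgaussianMGF (fun ω => ∑ i, ∑ j, E ω i j * A i j) (Real.toNNReal (σ ^ 2 * ‖A‖ ^ 2)) P

/-- Gaussian noise: independent entries, each with law `N(0, σ²)`. -/
def IsGaussianNoise {n m : ℕ} {Ω : Type*} [MeasurableSpace Ω] (P : Measure Ω)
    (E : Ω → Matrix (Fin n) (Fin m) ℝ) (σ : ℝ) : Prop :=
  iIndepFun (fun (ij : Fin n × Fin m) ω => E ω ij.1 ij.2) P ∧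
    ∀ i j, HasLaw (fun ω => E ω i j) (gaussianReal 0 (Real.toNNReal (σ ^ 2))) P

theorem frobenius_sq {n m : ℕ} (A : Matrix (Fin n) (Fin m) ℝ) :
    ‖A‖ ^ 2 = ∑ i, ∑ j, A i j ^ 2 := by
  have h0 : 0 ≤ ∑ i, ∑ j, A i j ^ 2 :=
    Finset.sum_nonneg fun i _ => Finset.sum_nonneg fun j _ => sq_nonneg _
  rw [Matrix.frobenius_norm_def, ← Real.sqrt_eq_rpow]
  simp only [Real.rpow_two, Real.norm_eq_abs, sq_abs]
  exact Real.sq_sqrt h0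

/-- Gaussian noise is an instance of sub-Gaussian noise of the same scale. -/
theorem IsGaussianNoise.isSubGaussianNoise {n m : ℕ} {Ω : Type*} [MeasurableSpace Ω]
    {P : Measure Ω} {E : Ω → Matrix (Fin n) (Fin m) ℝ} {σ : ℝ}
    (h : IsGaussianNoise P E σ) : IsSubGaussianNoise P E σ := by
  intro A
  obtain ⟨hind, hlaw⟩ := h
  have hind' : iIndepFun (fun (ij : Fin n × Fin m) ω => A ij.1 ij.2 * E ω ij.1 ij.2) P :=
    hind.comp (fun ij x => A ij.1 ij.2 * x) fun ij => measurable_const.mul measurable_id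
  have hsub : ∀ ij ∈ (Finset.univ : Finset (Fin n × Fin m)),
      HasSubgaussianMGF (fun ω => A ij.1 ij.2 * E ω ij.1 ij.2)
        (NNReal.mk (A ij.1 ij.2 ^ 2) (sq_nonneg _) * Real.toNNReal (σ ^ 2)) P := by
    intro ij _
    have hg : HasSubgaussianMGF (fun ω => E ω ij.1 ij.2) (Real.toNNReal (σ ^ 2)) P := by
      have hl := hlaw ij.1 ij.2
      refine ⟨fun t => ?_, fun t => ?_⟩
      · have := integrable_exp_mul_gaussianReal (μ := 0) (v := Real.toNNReal (σ ^ 2)) t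
        rw [← hl.map_eq] at this
        exact this.comp_aemeasurable hl.aemeasurable
      · rw [mgf_gaussianReal hl.map_eq]
        simp
    exact hg.const_mul _
  have hsum := HasSubgaussianMGF.sum_of_iIndepFun hind' hsub
  have hc : (∑ ij : Fin n × Fin m,
      NNReal.mk (A ij.1 ij.2 ^ 2) (sq_nonneg _) * Real.toNNReal (σ ^ 2))
      = Real.toNNReal (σ ^ 2 * ‖A‖ ^ 2) := by
    apply NNReal.eq
    rw [Real.coe_toNNReal _ (by positivity), frobenius_sq, NNReal.coe_sum, Fintype.sum_prod_type,
      Finset.mul_sum]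
    refine Finset.sum_congr rfl fun i _ => ?_
    rw [Finset.mul_sum]
    refine Finset.sum_congr rfl fun j _ => ?_
    rw [NNReal.coe_mul, Real.coe_toNNReal _ (sq_nonneg σ), mul_comm]
    rfl
  rw [hc] at hsum
  refine hsum.congr (Filter.Eventually.of_forall fun ω => ?_)
  simp only [Fintype.sum_prod_type]
  exact Finset.sum_congr rfl fun i _ => Finset.sum_congr rfl fun j _ => mul_comm _ _

end RobustRRR

/-! Write `Δ = X (Bhat - Bstar) + (Chat - Cstar)` and `Γ = Chat - Cstar`. Comparing the criterion at
the estimate and at the truth, and adding `1 - δ` times the regularity inequality with `δ = ϑ / (2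
(1 + ϑ))`, leaves enough slack to keep a full penalty: `n ‖Bhat - Bstar‖²` is at most twice `⟨E, Δ⟩
- ‖Δ‖² / 4 - δ lam ‖Γ‖_{2,1}`, plus a deterministic term of order `σ² ζ² (m + q) r`
(`IsEstimate.error_bound`). It remains to bound the expectation of the first term, uniformly over
`B` of rank at most `2 r` and over all `C` (`IsSubGaussianNoise.exists_compensated_bound`).

The matrix `C` is eliminated row by row. Optimizing a row of `C` by group soft thresholding either
sets it to zero or costs at least `μ²`, where `μ = δ lam`. So for some row set `J` the term is at
most `∑_{i ∈ J} (‖e_i‖² - μ²)` plus the same functional for `X B` with the rows in `J` erased. Half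
of each `μ²` pays for `‖e_i‖²`; the other half pays for the choice of `J`, through the weights
`n^{-|J|}`, whose sum is bounded.

The low-rank part needs no covering net. A convex function at a point of the unit ball is at most `2
^ d` times its average over the ball of radius two. Factoring `X B` through `ℝᵏ` makes `exp (s ⟨E, X
B⟩²)` convex in each factor separately, so two such averages bound it by `2 ^ (k (q + m))` times an
average over bounded fixed matrices, where the sub-Gaussian square has exponential moment at most 2.
The logarithm of that factor has the order of the degrees of freedom. This average is also a
measurable envelope, so no supremum has to be shown measurable. -/

namespace RobustRRR

/-! ### Averaging of convex functions and exponential moments of squares -/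

/-- On a finite-dimensional space, the value of a nonnegative convex function at a point of the
unit ball is at most `2 ^ d` times its average over the ball of radius two. -/
theorem exists_measure_convexOn_le (F : Type*) [NormedAddCommGroup F] [NormedSpace ℝ F]
    [FiniteDimensional ℝ F] [MeasurableSpace F] [BorelSpace F] :
    ∃ ν : Measure F, IsProbabilityMeasure ν ∧ (∀ᵐ x ∂ν, ‖x‖ ≤ 2) ∧
      ∀ f : F → ℝ, ConvexOn ℝ Set.univ f → Continuous f → (∀ x, 0 ≤ f x) → ∀ x, ‖x‖ ≤ 1 →
        ENNReal.ofReal (f x) ≤ 2 ^ Module.finrank ℝ F * ∫⁻ y, ENNReal.ofReal (f y) ∂ν := by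
  let μ : Measure F := Measure.addHaar
  set K₁ := Metric.closedBall (0 : F) 1
  set K₂ := Metric.closedBall (0 : F) 2
  have hK₁ : μ K₁ ≠ 0 := (Metric.measure_closedBall_pos μ 0 one_pos).ne'
  have hK₁t : μ K₁ ≠ ⊤ := measure_closedBall_lt_top.ne
  have hK₂ : μ K₂ ≠ 0 := (Metric.measure_closedBall_pos μ 0 two_pos).ne'
  have hK₂t : μ K₂ ≠ ⊤ := measure_closedBall_lt_top.ne
  have hvol : μ K₂ = 2 ^ Module.finrank ℝ F * μ K₁ := by
    have := Measure.addHaar_closedBall_mul μ (0 : F) (r := 2) (by norm_num) (s := 1) (by norm_num)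
    rw [mul_one, ENNReal.ofReal_pow (by norm_num)] at this
    simpa using this
  -- The uniform law on the ball of radius two, which contains the unit ball around every `x` with
  -- `‖x‖ ≤ 1`. The factor `2 ^ d` is the ratio of the two volumes.
  refine ⟨(μ K₂)⁻¹ • μ.restrict K₂, ⟨?_⟩, ?_, ?_⟩
  · simp [ENNReal.inv_mul_cancel hK₂ hK₂t]
  · refine Measure.ae_smul_measure ?_ _
    filter_upwards [ae_restrict_mem (μ := μ) (Metric.isClosed_closedBall.measurableSet)] with x hx
    simpa [K₂] using hx
  · intro f hconv hcont h0 x hx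
    set g : F → ENNReal := fun y => ENNReal.ofReal (f y)
    have hg : Measurable g := (ENNReal.measurable_ofReal.comp hcont.measurable)
    have hsub : ∀ e : F → F, (∀ h : F → ENNReal, ∫⁻ y, h (e y) ∂μ = ∫⁻ y, h y ∂μ) →
        (∀ y ∈ K₁, e y ∈ K₂) → ∫⁻ y in K₁, g (e y) ∂μ ≤ ∫⁻ y in K₂, g y ∂μ := by
      intro e he hmem
      rw [← lintegral_indicator Metric.isClosed_closedBall.measurableSet,
        ← lintegral_indicator Metric.isClosed_closedBall.measurableSet, ← he (K₂.indicator g)]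
      refine lintegral_mono fun y => ?_
      by_cases hy : y ∈ K₁
      · rw [Set.indicator_of_mem (show y ∈ Metric.closedBall 0 1 from hy),
          Set.indicator_of_mem (hmem y hy)]
      · rw [Set.indicator_of_notMem (show y ∉ Metric.closedBall 0 1 from hy)]
        exact zero_le
    have hp : ∫⁻ y in K₁, g (x + y) ∂μ ≤ ∫⁻ y in K₂, g y ∂μ := by
      refine hsub _ (fun h => lintegral_add_left_eq_self h x) fun y hy => ?_
      simp only [K₁, K₂, mem_closedBall_zero_iff] at hy ⊢
      linarith [norm_add_le x y]
    have hm : ∫⁻ y in K₁, g (x - y) ∂μ ≤ ∫⁻ y in K₂, g y ∂μ := by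
      refine hsub _ (fun h => lintegral_sub_left_eq_self h x) fun y hy => ?_
      simp only [K₁, K₂, mem_closedBall_zero_iff] at hy ⊢
      linarith [norm_sub_le x y]
    -- Midpoint convexity along `x ± y`; integrating over `y` in the unit ball yields the average.
    have hmid : ∀ y, 2 * g x ≤ g (x + y) + g (x - y) := by
      intro y
      have hle := hconv.2
      have := hle (Set.mem_univ (x + y)) (Set.mem_univ (x - y))
        (show (0 : ℝ) ≤ 1 / 2 by norm_num) (show (0 : ℝ) ≤ 1 / 2 by norm_num) (by norm_num)
      have hxy : (1 / 2 : ℝ) • (x + y) + (1 / 2 : ℝ) • (x - y) = x := by module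
      rw [hxy] at this
      simp only [smul_eq_mul] at this
      simp only [g]
      rw [← ENNReal.ofReal_add (h0 _) (h0 _), show (2 : ENNReal) = ENNReal.ofReal 2 by simp,
        ← ENNReal.ofReal_mul (by norm_num)]
      exact ENNReal.ofReal_le_ofReal (by linarith)
    have h2 : 2 * (g x * μ K₁) ≤ 2 * ∫⁻ y in K₂, g y ∂μ := by
      calc 2 * (g x * μ K₁) = ∫⁻ _ in K₁, 2 * g x ∂μ := by
            rw [setLIntegral_const, mul_assoc]
        _ ≤ ∫⁻ y in K₁, (g (x + y) + g (x - y)) ∂μ := lintegral_mono fun y => hmid y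
        _ = ∫⁻ y in K₁, g (x + y) ∂μ + ∫⁻ y in K₁, g (x - y) ∂μ :=
            lintegral_add_left (hg.comp (measurable_const_add x)) _
        _ ≤ _ := by rw [two_mul]; exact add_le_add hp hm
    have h1 : g x * μ K₁ ≤ ∫⁻ y in K₂, g y ∂μ :=
      (ENNReal.mul_le_mul_iff_right (by norm_num) (by norm_num)).1 h2
    rw [lintegral_smul_measure, smul_eq_mul, hvol]
    have h3 : g x ≤ (∫⁻ y in K₂, g y ∂μ) * (μ K₁)⁻¹ :=
      (ENNReal.le_div_iff_mul_le (Or.inl hK₁) (Or.inl hK₁t)).2 h1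
    refine h3.trans (le_of_eq ?_)
    rw [ENNReal.mul_inv (by simp) (by simp), ← mul_assoc, ← mul_assoc,
      ENNReal.mul_inv_cancel (by simp) (by simp), one_mul, mul_comm]

/-- Multiplying the `N(0, 1)` density by `exp (g² / 4)` gives `√2` times the `N(0, 2)` density, so
the integral is `√2`. -/
theorem lintegral_exp_sq_div_four_gaussianReal_le :
    ∫⁻ g, ENNReal.ofReal (Real.exp (g ^ 2 / 4)) ∂(gaussianReal 0 1) ≤ 2 := by
  have hpdf : ∀ g : ℝ, gaussianPDF 0 1 g * ENNReal.ofReal (Real.exp (g ^ 2 / 4))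
      = ENNReal.ofReal (√2) * gaussianPDF 0 2 g := by
    intro g
    rw [gaussianPDF, gaussianPDF, ← ENNReal.ofReal_mul (gaussianPDFReal_nonneg _ _ _),
      ← ENNReal.ofReal_mul (Real.sqrt_nonneg _), gaussianPDFReal, gaussianPDFReal]
    congr 1
    have h1 : Real.exp (-(g - 0) ^ 2 / (2 * ((2 : ℝ≥0) : ℝ)))
        = Real.exp (-(g - 0) ^ 2 / (2 * ((1 : ℝ≥0) : ℝ))) * Real.exp (g ^ 2 / 4) := by
      rw [← Real.exp_add]; congr 1; push_cast; ring
    have h2 : √(2 * Real.pi * ((2 : ℝ≥0) : ℝ)) = √(2 * Real.pi * ((1 : ℝ≥0) : ℝ)) * √2 := by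
      rw [← Real.sqrt_mul (by positivity)]; congr 1; push_cast; ring
    have h3 : √2 * (√2)⁻¹ = 1 := mul_inv_cancel₀ (by positivity)
    rw [h1, h2, mul_inv]
    linear_combination (-(√(2 * Real.pi * ((1 : ℝ≥0) : ℝ)))⁻¹ *
      Real.exp (-(g - 0) ^ 2 / (2 * ((1 : ℝ≥0) : ℝ))) * Real.exp (g ^ 2 / 4)) * h3
  rw [gaussianReal_of_var_ne_zero _ one_ne_zero,
    lintegral_withDensity_eq_lintegral_mul _ (measurable_gaussianPDF _ _) (by fun_prop)]
  simp only [Pi.mul_apply, hpdf]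
  rw [lintegral_const_mul _ (measurable_gaussianPDF _ _),
    lintegral_gaussianPDF_eq_one _ two_ne_zero, mul_one]
  refine ENNReal.ofReal_le_of_le_toReal ?_
  rw [ENNReal.toReal_ofNat, Real.sqrt_le_left (by norm_num)]
  norm_num

/-- The square is linearized by an independent standard Gaussian `g`: `exp (s X²)` is the mean of
`exp (√(2 s) X g)` over `g`. Integrating over `X` first leaves at most `exp (s v g²)`. -/
theorem lintegral_exp_mul_sq_le {Ω : Type*} [MeasurableSpace Ω] {P : Measure Ω} [SFinite P]
    {X : Ω → ℝ} {v : ℝ≥0} (hX : HasSubgaussianMGF X v P) {s : ℝ} (hs : 0 ≤ s)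
    (hsv : s * v ≤ 1 / 4) :
    ∫⁻ ω, ENNReal.ofReal (Real.exp (s * X ω ^ 2)) ∂P ≤ 2 := by
  set γ := gaussianReal 0 1
  have hgauss : ∀ t : ℝ, ∫⁻ g, ENNReal.ofReal (Real.exp (t * g)) ∂γ
      = ENNReal.ofReal (Real.exp (t ^ 2 / 2)) := by
    intro t
    rw [← ofReal_integral_eq_lintegral_ofReal (integrable_exp_mul_gaussianReal t)
      (Filter.Eventually.of_forall fun _ => (Real.exp_pos _).le)]
    have := mgf_gaussianReal (p := γ) (X := id) (μ := 0) (v := 1) (by simp [γ]) t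
    simp only [mgf, id] at this
    rw [this]; simp
  calc ∫⁻ ω, ENNReal.ofReal (Real.exp (s * X ω ^ 2)) ∂P
      = ∫⁻ ω, ∫⁻ g, ENNReal.ofReal (Real.exp (√(2 * s) * X ω * g)) ∂γ ∂P := by
        refine lintegral_congr fun ω => ?_
        rw [hgauss, mul_pow, Real.sq_sqrt (by positivity)]
        congr 2; ring
    _ = ∫⁻ g, ∫⁻ ω, ENNReal.ofReal (Real.exp (√(2 * s) * X ω * g)) ∂P ∂γ := by
        refine lintegral_lintegral_swap ?_
        have h1 : AEMeasurable (fun z : Ω × ℝ => X z.1) (P.prod γ) := hX.aemeasurable.comp_fst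
        exact (Real.measurable_exp.comp_aemeasurable
          ((h1.const_mul _).mul measurable_snd.aemeasurable)).ennreal_ofReal
    _ ≤ ∫⁻ g, ENNReal.ofReal (Real.exp (g ^ 2 / 4)) ∂γ := by
        refine lintegral_mono fun g => ?_
        have hint := hX.integrable_exp_mul (√(2 * s) * g)
        have : ∀ ω, √(2 * s) * X ω * g = √(2 * s) * g * X ω := fun ω => by ring
        simp only [this]
        rw [← ofReal_integral_eq_lintegral_ofReal hint
          (Filter.Eventually.of_forall fun _ => (Real.exp_pos _).le)]
        refine ENNReal.ofReal_le_ofReal ((hX.mgf_le _).trans (Real.exp_le_exp.2 ?_))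
        rw [mul_pow, Real.sq_sqrt (by positivity)]
        nlinarith [sq_nonneg g]
    _ ≤ 2 := lintegral_exp_sq_div_four_gaussianReal_le


theorem convexOn_exp_mul_sq {V : Type*} [AddCommGroup V] [Module ℝ V] {s : ℝ} (hs : 0 ≤ s)
    (φ : V →ₗ[ℝ] ℝ) : ConvexOn ℝ Set.univ fun x => Real.exp (s * φ x ^ 2) := by
  have h1 : ConvexOn ℝ Set.univ fun t : ℝ => s • t ^ 2 := (even_two.convexOn_pow).smul hs
  have h2 : ConvexOn ℝ Set.univ fun t : ℝ => Real.exp (s * t ^ 2) := by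
    refine ⟨convex_univ, fun x hx y hy a b ha hb hab => ?_⟩
    exact (Real.exp_le_exp.2 (h1.2 hx hy ha hb hab)).trans
      (convexOn_exp.2 (Set.mem_univ _) (Set.mem_univ _) ha hb hab)
  exact h2.comp_linearMap φ

/-! ### Envelopes for the low-rank part of the noise -/

/-- Finitely many vectors spanning a space of dimension at most `k` are the images, under a
contraction, of vectors of the same norms in `ℝᵏ`. -/
theorem exists_contraction_apply_eq {H ι : Type*} [NormedAddCommGroup H] [InnerProductSpace ℝ H]
    [FiniteDimensional ℝ H] (L : Submodule ℝ H) (x : ι → H) (hx : ∀ j, x j ∈ L) (k : ℕ)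
    (hk : Module.finrank ℝ (Submodule.span ℝ (Set.range x)) ≤ k) :
    ∃ (U : EuclideanSpace ℝ (Fin k) →L[ℝ] L) (v : ι → EuclideanSpace ℝ (Fin k)),
      ‖U‖ ≤ 1 ∧ ∀ j, (U (v j) : H) = x j ∧ ‖v j‖ = ‖x j‖ := by
  set R := Submodule.span ℝ (Set.range x)
  have hRL : R ≤ L := Submodule.span_le.2 (by rintro _ ⟨j, rfl⟩; exact hx j)
  have hxR : ∀ j, x j ∈ R := fun j => Submodule.subset_span ⟨j, rfl⟩
  let b := stdOrthonormalBasis ℝ R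
  let f : R →ₗ[ℝ] EuclideanSpace ℝ (Fin k) :=
    b.toBasis.constr ℝ fun i => EuclideanSpace.basisFun (Fin k) ℝ (Fin.castLE hk i)
  have hb : Orthonormal ℝ b.toBasis := by simp [b.orthonormal]
  have hf : Orthonormal ℝ (f ∘ b.toBasis) := by
    have : f ∘ b.toBasis = (EuclideanSpace.basisFun (Fin k) ℝ) ∘ Fin.castLE hk := by
      ext1 i
      simp only [f, Function.comp_apply, Module.Basis.constr_basis]
    rw [this]
    exact (EuclideanSpace.basisFun (Fin k) ℝ).orthonormal.comp _ (Fin.castLE_injective hk)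
  let ι' : R →ₗᵢ[ℝ] EuclideanSpace ℝ (Fin k) := f.isometryOfOrthonormal hb hf
  let ιc : R →L[ℝ] EuclideanSpace ℝ (Fin k) := ι'.toContinuousLinearMap
  -- The adjoint of an isometric embedding is a contraction and a left inverse of it.
  let U₀ : EuclideanSpace ℝ (Fin k) →L[ℝ] R := ContinuousLinearMap.adjoint ιc
  have hU₀ : ‖U₀‖ ≤ 1 := by
    rw [show ‖U₀‖ = ‖ιc‖ from LinearIsometryEquiv.norm_map _ _]
    exact ι'.norm_toContinuousLinearMap_le
  let incl : R →L[ℝ] L := LinearMap.toContinuousLinearMap (Submodule.inclusion hRL)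
  refine ⟨incl.comp U₀, fun j => ιc ⟨x j, hxR j⟩, ?_, fun j => ⟨?_, ?_⟩⟩
  · refine ContinuousLinearMap.opNorm_le_bound _ zero_le_one fun y => ?_
    have h1 : ‖incl (U₀ y)‖ = ‖U₀ y‖ := rfl
    rw [ContinuousLinearMap.comp_apply, h1]
    exact U₀.le_of_opNorm_le hU₀ y
  · have h1 : U₀ (ιc ⟨x j, hxR j⟩) = ⟨x j, hxR j⟩ := by
      refine ext_inner_right ℝ fun y => ?_
      rw [ContinuousLinearMap.adjoint_inner_left]
      exact ι'.inner_map_map _ _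
    rw [ContinuousLinearMap.comp_apply, h1]
    rfl
  · exact ι'.norm_map _

theorem finrank_range_toLpLin {n p : ℕ} (X : Matrix (Fin n) (Fin p) ℝ) :
    Module.finrank ℝ (LinearMap.range (Matrix.toLpLin 2 2 X)) = X.rank := by
  rw [Matrix.toLpLin_eq_toLin, ← Matrix.rank_eq_finrank_range_toLin]

/-- The `m`-tuples of vectors of `ℝᵏ`, with the Euclidean norm. -/
abbrev CoordSpace (k m : ℕ) := PiLp 2 fun _ : Fin m => EuclideanSpace ℝ (Fin k)

/-- The exponential of the squared pairing of `W` with the matrices `X B` of rank at most `k` in the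
Frobenius unit ball is dominated by its average over a bounded random matrix. -/
theorem exists_measure_exp_mul_sq_le {n p : ℕ} (m : ℕ) (X : Matrix (Fin n) (Fin p) ℝ) (k : ℕ) :
    ∃ ρ : Measure (Fin n → Fin m → ℝ), IsProbabilityMeasure ρ ∧
      (∀ᵐ M ∂ρ, ∑ i, ∑ j, M i j ^ 2 ≤ 16) ∧
      ∀ s : ℝ, 0 ≤ s → ∀ (W : Fin n → Fin m → ℝ) (B : Matrix (Fin p) (Fin m) ℝ),
        B.rank ≤ k → ‖X * B‖ ≤ 1 →
        ENNReal.ofReal (Real.exp (s * (∑ i, ∑ j, W i j * (X * B) i j) ^ 2)) ≤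
          2 ^ (k * (X.rank + m)) *
            ∫⁻ M, ENNReal.ofReal (Real.exp (s * (∑ i, ∑ j, W i j * M i j) ^ 2)) ∂ρ := by
  let L := LinearMap.range (Matrix.toLpLin 2 2 X)
  let F := EuclideanSpace ℝ (Fin k) →L[ℝ] L
  have hF : Module.finrank ℝ F = k * X.rank := by
    rw [← finrank_range_toLpLin X,
      ← (LinearMap.toContinuousLinearMap (𝕜 := ℝ) (E := EuclideanSpace ℝ (Fin k))
        (F' := L)).finrank_eq, Module.finrank_linearMap]
    simp [L]
  have hG : Module.finrank ℝ (CoordSpace k m) = k * m := by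
    rw [(WithLp.linearEquiv 2 ℝ (Fin m → EuclideanSpace ℝ (Fin k))).finrank_eq]
    simp [Module.finrank_pi_fintype, mul_comm]
  have : FiniteDimensional ℝ F :=
    (LinearMap.toContinuousLinearMap (𝕜 := ℝ) (E := EuclideanSpace ℝ (Fin k))
        (F' := L)).finiteDimensional
  have : FiniteDimensional ℝ (CoordSpace k m) := inferInstance
  borelize (CoordSpace k m)
  obtain ⟨νF, hνF, hνF2, hdomF⟩ := exists_measure_convexOn_le F
  obtain ⟨νG, hνG, hνG2, hdomG⟩ := exists_measure_convexOn_le (CoordSpace k m)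
  -- The bilinear factorization map: column `j` is the image of the `j`-th vector under the
  -- operator. Both factors have norm at most 2 almost surely, whence the bound `16 = (2 · 2)²`.
  let T : F × CoordSpace k m → Fin n → Fin m → ℝ := fun z i j =>
    ((z.1 (z.2 j) : L) : EuclideanSpace ℝ (Fin n)) i
  have hTc : Continuous T := by
    refine continuous_pi fun i => continuous_pi fun j => ?_
    have h0 : Continuous fun x : PiLp 2 fun _ : Fin m => EuclideanSpace ℝ (Fin k) => x j :=
      PiLp.continuous_apply 2 _ j
    have h1 : Continuous fun z : F × CoordSpace k m => z.2 j :=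
      Continuous.comp (X := F × CoordSpace k m) h0 continuous_snd
    have h2 : Continuous fun z : F × CoordSpace k m => z.1 (z.2 j) := continuous_fst.clm_apply h1
    fun_prop
  have hsq : ∀ z : F × CoordSpace k m, ∑ i, ∑ j, T z i j ^ 2 = ∑ j, ‖z.1 (z.2 j)‖ ^ 2 := by
    intro z
    rw [Finset.sum_comm]
    refine Finset.sum_congr rfl fun j _ => ?_
    rw [show ‖z.1 (z.2 j)‖ = ‖((z.1 (z.2 j) : L) : EuclideanSpace ℝ (Fin n))‖ from rfl,
      EuclideanSpace.norm_sq_eq]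
    simp [T]
  have hmeas : ∀ (s : ℝ) (W : Fin n → Fin m → ℝ), Measurable fun M : Fin n → Fin m → ℝ =>
      ENNReal.ofReal (Real.exp (s * (∑ i, ∑ j, W i j * M i j) ^ 2)) := by
    intro s W
    fun_prop
  refine ⟨(νF.prod νG).map T, Measure.isProbabilityMeasure_map hTc.measurable.aemeasurable,
    ?_, ?_⟩
  · rw [ae_map_iff hTc.measurable.aemeasurable (measurableSet_le (by fun_prop) (by fun_prop))]
    have h1 : ∀ᵐ z ∂νF.prod νG, ‖z.1‖ ≤ 2 := Measure.quasiMeasurePreserving_fst.ae hνF2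
    have h2 : ∀ᵐ z ∂νF.prod νG, ‖z.2‖ ≤ 2 := Measure.quasiMeasurePreserving_snd.ae hνG2
    filter_upwards [h1, h2] with z hz1 hz2
    rw [hsq]
    calc ∑ j, ‖z.1 (z.2 j)‖ ^ 2 ≤ ∑ j, (2 * ‖z.2 j‖) ^ 2 := by
          gcongr with j
          exact z.1.le_of_opNorm_le hz1 _
      _ = 4 * ‖z.2‖ ^ 2 := by
          rw [PiLp.norm_sq_eq_of_L2, Finset.mul_sum]
          exact Finset.sum_congr rfl fun j _ => by ring
      _ ≤ 16 := by nlinarith [norm_nonneg z.2]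
  · intro s hs W B hB hXB
    -- The columns of `X * B` span a space of dimension at most `k` inside the range of `X`. The
    -- contraction has norm at most 1, and the tuple `v` carries the whole Frobenius norm of `X *
    -- B`.
    obtain ⟨U, v, hU, hUv⟩ := exists_contraction_apply_eq L
      (fun j : Fin m => Matrix.toLpLin 2 2 X (WithLp.toLp 2 fun l => B l j))
      (fun j => ⟨_, rfl⟩) k (by
        refine le_trans ?_ ((Matrix.rank_mul_le_right X B).trans hB)
        rw [← finrank_range_toLpLin]
        refine Submodule.finrank_mono (Submodule.span_le.2 ?_)
        rintro _ ⟨j, rfl⟩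
        refine ⟨EuclideanSpace.single j 1, ?_⟩
        ext i
        simp [Matrix.toLpLin_apply, Matrix.mulVec, dotProduct])
    let w : CoordSpace k m := WithLp.toLp 2 v
    have hT : ∀ i j, T (U, w) i j = (X * B) i j := by
      intro i j
      have : ((U (w j) : L) : EuclideanSpace ℝ (Fin n)) = _ := (hUv j).1
      simp only [T, this]
      simp [Matrix.toLpLin_apply, Matrix.mul_apply, Matrix.mulVec, dotProduct]
    have hw : ‖w‖ ≤ 1 := by
      have h1 : ‖w‖ ^ 2 = ‖X * B‖ ^ 2 := by
        rw [PiLp.norm_sq_eq_of_L2, frobenius_sq, Finset.sum_comm]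
        refine Finset.sum_congr rfl fun j _ => ?_
        rw [show ‖w j‖ = _ from (hUv j).2, EuclideanSpace.norm_sq_eq]
        simp [Matrix.toLpLin_apply, Matrix.mul_apply, Matrix.mulVec, dotProduct]
      have h2 := norm_nonneg w
      have h3 := norm_nonneg (X * B)
      nlinarith
    let φ : F × CoordSpace k m → ℝ := fun z => ∑ i, ∑ j, W i j * T z i j
    have hφ : Continuous φ := by fun_prop
    let f : F → CoordSpace k m → ℝ := fun u x => Real.exp (s * φ (u, x) ^ 2)
    have hcF : ∀ x, ConvexOn ℝ Set.univ fun u => f u x := fun x =>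
      convexOn_exp_mul_sq hs
        { toFun := fun u => φ (u, x)
          map_add' := fun u u' => by simp [φ, T, mul_add, Finset.sum_add_distrib]
          map_smul' := fun c u => by simp [φ, T, Finset.mul_sum, mul_left_comm] }
    have hadd : ∀ (x x' : CoordSpace k m) j, (x + x') j = x j + x' j := fun _ _ _ => rfl
    have hsmul : ∀ (c : ℝ) (x : CoordSpace k m) j, (c • x) j = c • x j := fun _ _ _ => rfl
    have hcG : ∀ u, ConvexOn ℝ Set.univ fun x => f u x := fun u =>
      convexOn_exp_mul_sq hs
        { toFun := fun x => φ (u, x)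
          map_add' := fun x x' => by simp [hadd, φ, T, mul_add, Finset.sum_add_distrib]
          map_smul' := fun c x => by simp [hsmul, φ, T, Finset.mul_sum, mul_left_comm] }
    have hcont : Continuous fun z : F × CoordSpace k m => f z.1 z.2 := by fun_prop
    -- The exponential is not jointly convex in both factors, so the averaging is applied to one
    -- factor at a time.
    have h1 := hdomF (fun u => f u w) (hcF w) (by fun_prop) (fun _ => (Real.exp_pos _).le) U hU
    have h2 : ∀ u, ENNReal.ofReal (f u w) ≤ _ := fun u =>
      hdomG (fun x => f u x) (hcG u) (by fun_prop) (fun _ => (Real.exp_pos _).le) w hw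
    have hmeas' : Measurable fun z : F × CoordSpace k m => ENNReal.ofReal (f z.1 z.2) :=
      hcont.measurable.ennreal_ofReal
    have h3 : ∫⁻ M, ENNReal.ofReal (Real.exp (s * (∑ i, ∑ j, W i j * M i j) ^ 2))
        ∂(νF.prod νG).map T = ∫⁻ u, ∫⁻ x, ENNReal.ofReal (f u x) ∂νG ∂νF := by
      rw [lintegral_map (hmeas s W) hTc.measurable]
      exact lintegral_prod _ hmeas'.aemeasurable
    rw [h3]
    calc ENNReal.ofReal (Real.exp (s * (∑ i, ∑ j, W i j * (X * B) i j) ^ 2))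
        = ENNReal.ofReal (f U w) := by simp only [f, φ, hT]
      _ ≤ 2 ^ Module.finrank ℝ F * ∫⁻ u, ENNReal.ofReal (f u w) ∂νF := h1
      _ ≤ 2 ^ Module.finrank ℝ F *
          ∫⁻ u, 2 ^ Module.finrank ℝ (CoordSpace k m) * ∫⁻ x, ENNReal.ofReal (f u x) ∂νG ∂νF := by
          gcongr with u
          exact h2 u
      _ = _ := by
          rw [lintegral_const_mul _ hmeas'.lintegral_prod_right', hF, hG, ← mul_assoc, ← pow_add,
            mul_add]

/-- For sub-Gaussian noise, the exponential of the squared pairing with the matrices `X B` of rank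
at most `k` in the Frobenius unit ball has an envelope of controlled expectation. -/
theorem IsSubGaussianNoise.exists_envelope {n p m : ℕ} {Ω : Type*} [MeasurableSpace Ω]
    {P : Measure Ω} [IsProbabilityMeasure P] {E : Ω → Matrix (Fin n) (Fin m) ℝ} {σ : ℝ}
    (hσ : 0 < σ) (hE : IsSubGaussianNoise P E σ) (X : Matrix (Fin n) (Fin p) ℝ) (k : ℕ) :
    ∃ Φ : Ω → ENNReal, AEMeasurable Φ P ∧ ∫⁻ ω, Φ ω ∂P ≤ 2 ^ (k * (X.rank + m)) * 2 ∧
      ∀ ω (B : Matrix (Fin p) (Fin m) ℝ), B.rank ≤ k → ‖X * B‖ ≤ 1 →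
        ENNReal.ofReal
          (Real.exp ((∑ i, ∑ j, E ω i j * (X * B) i j) ^ 2 / (64 * σ ^ 2))) ≤ Φ ω := by
  obtain ⟨ρ, hρ, hρ16, hdom⟩ := exists_measure_exp_mul_sq_le m X k
  -- Chosen so that `s · 16 σ² = 1 / 4`, the limit for the exponential moment of the square.
  set s : ℝ := (64 * σ ^ 2)⁻¹
  have hs : 0 ≤ s := by positivity
  have hEm : ∀ i j, AEMeasurable (fun ω => E ω i j) P := by
    intro i j
    refine (hE (Matrix.single i j 1)).aemeasurable.congr (Filter.Eventually.of_forall fun ω => ?_)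
    simp only [Matrix.single_apply]
    rw [Finset.sum_eq_single i _ (by simp), Finset.sum_eq_single j _ (by simp)]
    · simp
    · intro b _ hb; simp [hb.symm]
    · intro b _ hb; simp [hb.symm]
  set h : Ω × (Fin n → Fin m → ℝ) → ENNReal := fun z =>
    ENNReal.ofReal (Real.exp (s * (∑ i, ∑ j, E z.1 i j * z.2 i j) ^ 2))
  have hh : AEMeasurable h (P.prod ρ) := by
    have h1 : ∀ i j, AEMeasurable (fun z : Ω × (Fin n → Fin m → ℝ) => E z.1 i j) (P.prod ρ) :=
      fun i j => (hEm i j).comp_fst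
    have h2 : ∀ i j, Measurable (fun z : Ω × (Fin n → Fin m → ℝ) => z.2 i j) := by
      intro i j; fun_prop
    have h3 : AEMeasurable (fun z : Ω × (Fin n → Fin m → ℝ) =>
        ∑ i, ∑ j, E z.1 i j * z.2 i j) (P.prod ρ) :=
      Finset.aemeasurable_fun_sum _ fun i _ => Finset.aemeasurable_fun_sum _ fun j _ =>
        (h1 i j).mul (h2 i j).aemeasurable
    exact (Real.measurable_exp.comp_aemeasurable ((h3.pow_const 2).const_mul s)).ennreal_ofReal
  refine ⟨fun ω => 2 ^ (k * (X.rank + m)) * ∫⁻ M, h (ω, M) ∂ρ,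
    hh.lintegral_prod_right'.const_mul _, ?_, ?_⟩
  · rw [lintegral_const_mul'' _ hh.lintegral_prod_right']
    gcongr
    rw [lintegral_lintegral_swap (f := fun ω M => h (ω, M)) hh]
    calc ∫⁻ M, ∫⁻ ω, h (ω, M) ∂P ∂ρ ≤ ∫⁻ _, 2 ∂ρ := by
          refine lintegral_mono_ae ?_
          filter_upwards [hρ16] with M hM
          refine lintegral_exp_mul_sq_le (hE (Matrix.of M)) hs ?_
          rw [Real.coe_toNNReal _ (by positivity), frobenius_sq]
          simp only [Matrix.of_apply, s]
          rw [inv_mul_le_iff₀ (by positivity)]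
          nlinarith [sq_nonneg σ]
      _ = 2 := by simp
  · intro ω B hB hXB
    convert hdom s hs (fun i j => E ω i j) B hB hXB using 4
    rw [div_eq_inv_mul]


theorem rank_smul_le {p m : ℕ} (c : ℝ) (B : Matrix (Fin p) (Fin m) ℝ) : (c • B).rank ≤ B.rank := by
  have : c • B = (c • (1 : Matrix (Fin p) (Fin p) ℝ)) * B := by simp
  rw [this]
  exact Matrix.rank_mul_le_right _ _

theorem rank_sub_le {p m : ℕ} (A B : Matrix (Fin p) (Fin m) ℝ) :
    (A - B).rank ≤ A.rank + B.rank := by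
  rw [Matrix.rank, Matrix.rank, Matrix.rank]
  refine le_trans (Submodule.finrank_mono ?_) (Submodule.finrank_add_le_finrank_add_finrank _ _)
  rintro _ ⟨x, rfl⟩
  rw [Matrix.mulVecLin_apply, Matrix.sub_mulVec]
  exact Submodule.sub_mem _ (Submodule.mem_sup_left ⟨x, rfl⟩) (Submodule.mem_sup_right ⟨x, rfl⟩)

/-- Homogeneous form of `IsSubGaussianNoise.exists_envelope`, without a norm constraint. -/
theorem IsSubGaussianNoise.exists_penalized_envelope {n p m : ℕ} {Ω : Type*} [MeasurableSpace Ω]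
    {P : Measure Ω} [IsProbabilityMeasure P] {E : Ω → Matrix (Fin n) (Fin m) ℝ} {σ : ℝ}
    (hσ : 0 < σ) (hE : IsSubGaussianNoise P E σ) (X : Matrix (Fin n) (Fin p) ℝ) (k : ℕ) :
    ∃ Φ : Ω → ENNReal, AEMeasurable Φ P ∧ ∫⁻ ω, Φ ω ∂P ≤ 2 ^ (k * (X.rank + m)) * 2 ∧
      ∀ ω (B : Matrix (Fin p) (Fin m) ℝ), B.rank ≤ k →
        ENNReal.ofReal (Real.exp
          ((∑ i, ∑ j, E ω i j * (X * B) i j - ‖X * B‖ ^ 2 / 4) / (64 * σ ^ 2))) ≤ Φ ω := by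
  obtain ⟨Φ, hΦm, hΦ, hle⟩ := hE.exists_envelope hσ X k
  refine ⟨Φ, hΦm, hΦ, fun ω B hB => ?_⟩
  by_cases h0 : ‖X * B‖ = 0
  · have h1 : X * B = 0 := norm_eq_zero.1 h0
    have := hle ω 0 (by simp) (by simp)
    simpa [h1] using this
  · have hpos : 0 < ‖X * B‖ := lt_of_le_of_ne (norm_nonneg _) (Ne.symm h0)
    have hB' : X * (‖X * B‖⁻¹ • B) = ‖X * B‖⁻¹ • (X * B) := Matrix.mul_smul _ _ _
    have := hle ω (‖X * B‖⁻¹ • B) ((rank_smul_le _ _).trans hB) (by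
      rw [hB', norm_smul, norm_inv, norm_norm, inv_mul_cancel₀ h0])
    refine le_trans (ENNReal.ofReal_le_ofReal (Real.exp_le_exp.2 ?_)) this
    gcongr
    rw [hB']
    simp only [Matrix.smul_apply, smul_eq_mul, mul_left_comm _ ‖X * B‖⁻¹, ← Finset.mul_sum]
    set y := ∑ i, ∑ j, E ω i j * (X * B) i j
    have h2 : y = ‖X * B‖ * (‖X * B‖⁻¹ * y) := by rw [mul_inv_cancel_left₀ h0]
    -- With `t = ‖X * B‖`, this is `y - t² / 4 ≤ (y / t)²`.
    nlinarith [sq_nonneg (‖X * B‖⁻¹ * y - ‖X * B‖ / 2)]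

/-! ### Eliminating `C` row by row -/

/-- Partial minimization over `c` of a quadratic loss with penalty `‖c‖`: either `c` may be taken
to vanish, or the penalty contributes at least `μ ^ 2`. -/
theorem inner_add_sub_penalty_le {V : Type*} [NormedAddCommGroup V] [InnerProductSpace ℝ V]
    (e x c : V) {μ : ℝ} (hμ : 0 ≤ μ) :
    inner ℝ e (x + c) - ‖x + c‖ ^ 2 / 4 - μ * ‖c‖ ≤
      max (‖e‖ ^ 2 - μ ^ 2) (inner ℝ e x - ‖x‖ ^ 2 / 4) := by
  -- Completing the square: what remains is to minimize `‖z - c‖² / 4 + μ ‖c‖`, whose minimizer is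
  -- zero exactly when `‖z‖ ≤ 2 μ`.
  set z := (2 : ℝ) • e - x
  have h1 : inner ℝ e (x + c) - ‖x + c‖ ^ 2 / 4 = ‖e‖ ^ 2 - ‖z - c‖ ^ 2 / 4 := by
    have : z - c = (2 : ℝ) • e - (x + c) := by simp only [z]; abel
    rw [this, norm_sub_sq_real, inner_smul_left, norm_smul]
    simp; ring
  have h2 : inner ℝ e x - ‖x‖ ^ 2 / 4 = ‖e‖ ^ 2 - ‖z‖ ^ 2 / 4 := by
    rw [norm_sub_sq_real, inner_smul_left, norm_smul]
    simp; ring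
  rw [h1, h2]
  have hz := norm_nonneg z
  have hc := norm_nonneg c
  have hzc := norm_nonneg (z - c)
  have h4 : (‖z‖ - ‖c‖) ^ 2 ≤ ‖z - c‖ ^ 2 := by
    have h5 := abs_norm_sub_norm_le z c
    rw [← sq_abs (‖z‖ - ‖c‖)]
    gcongr
  rcases le_total ‖z‖ (2 * μ) with h | h
  · refine le_trans ?_ (le_max_right _ _)
    nlinarith [mul_nonneg hc (sub_nonneg.2 h)]
  · refine le_trans ?_ (le_max_left _ _)
    rcases le_total μ ‖c‖ with h' | h'
    · nlinarith [mul_nonneg hμ (sub_nonneg.2 h')]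
    · nlinarith [mul_nonneg hμ (sub_nonneg.2 h'), sq_nonneg ‖c‖,
        mul_nonneg (sub_nonneg.2 h) (by linarith : 0 ≤ ‖z‖ + 2 * μ - 2 * ‖c‖)]

theorem norm_sq_eq_sum_rows {n m : ℕ} (A : Matrix (Fin n) (Fin m) ℝ) :
    ‖A‖ ^ 2 = ∑ i, ‖WithLp.toLp 2 (A i)‖ ^ 2 := by
  rw [frobenius_sq]
  exact Finset.sum_congr rfl fun i _ => by simp [EuclideanSpace.norm_sq_eq]

theorem inner_rows {m : ℕ} (a b : Fin m → ℝ) :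
    inner ℝ (WithLp.toLp 2 a) (WithLp.toLp 2 b) = ∑ j, a j * b j := by
  simp [PiLp.inner_apply, mul_comm]

/-- The matrix `X` with the rows in `J` replaced by zero. -/
def eraseRows {n p : ℕ} (J : Finset (Fin n)) (X : Matrix (Fin n) (Fin p) ℝ) :
    Matrix (Fin n) (Fin p) ℝ :=
  Matrix.diagonal (fun i => if i ∈ J then (0 : ℝ) else 1) * X

theorem eraseRows_apply {n p : ℕ} (J : Finset (Fin n)) (X : Matrix (Fin n) (Fin p) ℝ) (i j) :
    eraseRows J X i j = if i ∈ J then 0 else X i j := by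
  simp [eraseRows, Matrix.diagonal_mul]

theorem exists_finset_pairing_sub_penalty_le {n m : ℕ} (W M C : Matrix (Fin n) (Fin m) ℝ) {μ : ℝ}
    (hμ : 0 ≤ μ) : ∃ J : Finset (Fin n),
      ∑ i, ∑ j, W i j * (M + C) i j - ‖M + C‖ ^ 2 / 4 - μ * norm21 C ≤
        ∑ i ∈ J, (‖WithLp.toLp 2 (W i)‖ ^ 2 - μ ^ 2) +
          (∑ i, ∑ j, W i j * eraseRows J M i j - ‖eraseRows J M‖ ^ 2 / 4) := by
  classical
  set a : Fin n → ℝ := fun i => ‖WithLp.toLp 2 (W i)‖ ^ 2 - μ ^ 2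
  set b : Fin n → ℝ := fun i =>
    inner ℝ (WithLp.toLp 2 (W i)) (WithLp.toLp 2 (M i)) - ‖WithLp.toLp 2 (M i)‖ ^ 2 / 4
  -- The rows where paying `μ²` beats taking the row of `C` to be zero; off `J` only the row of `M`
  -- survives.
  set J : Finset (Fin n) := Finset.univ.filter fun i => b i ≤ a i
  refine ⟨J, ?_⟩
  have hrhs : ∑ i, ∑ j, W i j * eraseRows J M i j - ‖eraseRows J M‖ ^ 2 / 4
      = ∑ i, if i ∈ J then 0 else b i := by
    rw [norm_sq_eq_sum_rows, Finset.sum_div, ← Finset.sum_sub_distrib]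
    refine Finset.sum_congr rfl fun i _ => ?_
    rw [← inner_rows]
    by_cases hi : i ∈ J
    · have : eraseRows J M i = 0 := by ext j; simp [eraseRows_apply, hi]
      simp [this, hi]
    · have : eraseRows J M i = M i := by ext j; simp [eraseRows_apply, hi]
      simp only [this, hi, if_false, b]
  have hJ : ∑ i ∈ J, a i = ∑ i, if i ∈ J then a i else 0 := by simp
  rw [hrhs, hJ, ← Finset.sum_add_distrib, norm_sq_eq_sum_rows, norm21, norm21On, Finset.mul_sum,
    Finset.sum_div, ← Finset.sum_sub_distrib, ← Finset.sum_sub_distrib]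
  refine Finset.sum_le_sum fun i _ => ?_
  have h := inner_add_sub_penalty_le (WithLp.toLp 2 (W i)) (WithLp.toLp 2 (M i))
    (WithLp.toLp 2 (C i)) hμ
  rw [← WithLp.toLp_add, inner_rows] at h
  refine h.trans ?_
  by_cases hi : b i ≤ a i
  · have : i ∈ J := by simp [J, hi]
    simp only [this, if_true, add_zero]
    exact max_le le_rfl hi
  · have : i ∉ J := by simpa [J] using hi
    simp only [this, if_false, zero_add]
    exact max_le (le_of_not_ge hi) le_rfl


/-! ### Expected bound for the compensated noise -/

/-- From `t ≤ exp t`: an exponential moment bounds the expected excess over `K`, with a gain `exp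
(-K / a)` that later cancels dimensions and cardinalities. -/
theorem ofReal_sub_le_exp_mul {a x K : ℝ} {Φ : ENNReal} (ha : 0 < a)
    (h : ENNReal.ofReal (Real.exp (x / a)) ≤ Φ) :
    ENNReal.ofReal (x - K) ≤ ENNReal.ofReal (a * Real.exp (-(K / a))) * Φ := by
  refine le_trans ?_ (mul_le_mul_right h _)
  rw [← ENNReal.ofReal_mul (by positivity)]
  refine ENNReal.ofReal_le_ofReal ?_
  rw [mul_assoc, ← Real.exp_add]
  have h1 := Real.add_one_le_exp (-(K / a) + x / a)
  calc x - K = a * (-(K / a) + x / a) := by field_simp; ring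
    _ ≤ _ := by gcongr; linarith

theorem sum_inv_pow_card_le {n : ℕ} (hn : 0 < n) :
    ∑ J : Finset (Fin n), ((n : ℝ)⁻¹) ^ J.card ≤ 3 := by
  have h := Finset.sum_pow_mul_eq_add_pow ((n : ℝ)⁻¹) 1 (Finset.univ : Finset (Fin n))
  simp only [one_pow, mul_one, Finset.powerset_univ, Finset.card_univ, Fintype.card_fin] at h
  rw [h]
  calc ((n : ℝ)⁻¹ + 1) ^ n ≤ Real.exp ((n : ℝ)⁻¹) ^ n := by
        gcongr; exact Real.add_one_le_exp _
    _ = Real.exp 1 := by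
        rw [← Real.exp_nat_mul, mul_inv_cancel₀ (by positivity)]
    _ ≤ 3 := Real.exp_one_lt_three.le

theorem two_pow_le_exp (k : ℕ) : (2 : ℝ) ^ k ≤ Real.exp k := by
  rw [← mul_one (k : ℝ), Real.exp_nat_mul]
  gcongr
  linarith [Real.add_one_le_exp (1 : ℝ)]

/-- The matrix with a single column, the `i`-th vector of the standard basis. -/
def unitColumn {n : ℕ} (i : Fin n) : Matrix (Fin n) (Fin 1) ℝ :=
  Matrix.of fun l _ => if l = i then 1 else 0

theorem unitColumn_mul_apply {n m : ℕ} (i : Fin n) (B : Matrix (Fin 1) (Fin m) ℝ) (l j) :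
    (unitColumn i * B) l j = if l = i then B 0 j else 0 := by
  simp [unitColumn, Matrix.mul_apply]

/-- Realizes the squared row norm as a value of the penalized rank-one pairing, so the low-rank
envelope also controls single rows of the noise. -/
theorem pairing_unitColumn_sub {n m : ℕ} (W : Matrix (Fin n) (Fin m) ℝ) (i : Fin n) :
    ∑ l, ∑ j, W l j * (unitColumn i * Matrix.of fun _ : Fin 1 => (2 : ℝ) • W i) l j -
      ‖unitColumn i * Matrix.of fun _ : Fin 1 => (2 : ℝ) • W i‖ ^ 2 / 4 =
      ‖WithLp.toLp 2 (W i)‖ ^ 2 := by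
  rw [frobenius_sq]
  simp only [unitColumn_mul_apply]
  rw [Finset.sum_eq_single i (by intro l _ hl; simp [hl]) (by simp),
    Finset.sum_eq_single (f := fun l => ∑ j, (if l = i then _ else (0 : ℝ)) ^ 2) i
      (by intro l _ hl; simp [hl]) (by simp), EuclideanSpace.norm_sq_eq, Finset.sum_div,
    ← Finset.sum_sub_distrib]
  refine Finset.sum_congr rfl fun j _ => ?_
  simp
  ring

/-- The noise pairing with `X B + C`, compensated by a quadratic term and a multiple of
`‖C‖_{2,1}`, is bounded in expectation by a multiple of the number of degrees of freedom,
uniformly over all `B` of rank at most `2 r` and all `C`. -/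
theorem IsSubGaussianNoise.exists_compensated_bound {n p m r : ℕ} {Ω : Type*} [MeasurableSpace Ω]
    {P : Measure Ω} [IsProbabilityMeasure P] {E : Ω → Matrix (Fin n) (Fin m) ℝ} {σ μ : ℝ}
    (hn : 0 < n) (hm : 0 < m) (hr : 0 < r) (hσ : 0 < σ) (hE : IsSubGaussianNoise P E σ)
    (X : Matrix (Fin n) (Fin p) ℝ) (hμ : 0 ≤ μ)
    (hμ2 : 128 * σ ^ 2 * (m + Real.log n) ≤ μ ^ 2) :
    ∃ R : Ω → ENNReal, AEMeasurable R P ∧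
      ∫⁻ ω, R ω ∂P ≤ ENNReal.ofReal (768 * (σ ^ 2 * (((m : ℝ) + X.rank) * r))) ∧
      ∀ ω (B : Matrix (Fin p) (Fin m) ℝ) (C : Matrix (Fin n) (Fin m) ℝ), B.rank ≤ 2 * r →
        ENNReal.ofReal (∑ i, ∑ j, E ω i j * (X * B + C) i j - ‖X * B + C‖ ^ 2 / 4
          - μ * norm21 C) ≤ R ω := by
  set a : ℝ := 64 * σ ^ 2 with ha_def
  have ha : 0 < a := by positivity
  set D : ℕ := 2 * r * (X.rank + m) with hD
  set L : ℝ := μ ^ 2 / 2 / a with hL_def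
  have hL : m + Real.log n ≤ L := by
    rw [hL_def, div_div, le_div_iff₀ (by positivity)]
    rw [ha_def]; linarith
  have hn' : (0 : ℝ) < n := by exact_mod_cast hn
  have hlog : 0 ≤ Real.log n := Real.log_natCast_nonneg n
  have hexplog : Real.exp (-Real.log n) = (n : ℝ)⁻¹ := by rw [Real.exp_neg, Real.exp_log hn']
  choose Ψ hΨm hΨ hΨle using fun i : Fin n => hE.exists_penalized_envelope hσ (unitColumn i) 1
  choose Φ hΦm hΦ hΦle using fun J : Finset (Fin n) =>
    hE.exists_penalized_envelope hσ (eraseRows J X) (2 * r)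
  -- A deterministic level, the row excesses over `μ² / 2`, and the low-rank excesses over all `J`.
  -- The level `a D` cancels the envelope factor `2 ^ D`; the extra `|J| μ² / 2` produces the weight
  -- `n^{-|J|}`.
  refine ⟨fun ω => ENNReal.ofReal (a * D) +
      ∑ i, ENNReal.ofReal (a * Real.exp (-(μ ^ 2 / 2 / a))) * Ψ i ω +
      ∑ J : Finset (Fin n),
        ENNReal.ofReal (a * Real.exp (-((a * D + J.card * (μ ^ 2 / 2)) / a))) * Φ J ω,
    ?_, ?_, ?_⟩
  · exact (aemeasurable_const.add (Finset.aemeasurable_fun_sum _ fun i _ =>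
      (hΨm i).const_mul _)).add (Finset.aemeasurable_fun_sum _ fun J _ => (hΦm J).const_mul _)
  · rw [lintegral_add_right' _ (Finset.aemeasurable_fun_sum _ fun J _ => (hΦm J).const_mul _),
      lintegral_add_right' _ (Finset.aemeasurable_fun_sum _ fun i _ => (hΨm i).const_mul _),
      lintegral_finsetSum' _ fun i _ => (hΨm i).const_mul _,
      lintegral_finsetSum' _ fun J _ => (hΦm J).const_mul _]
    have hrow : ∀ i : Fin n,
        ∫⁻ ω, ENNReal.ofReal (a * Real.exp (-(μ ^ 2 / 2 / a))) * Ψ i ω ∂P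
          ≤ ENNReal.ofReal (4 * a * (n : ℝ)⁻¹) := by
      intro i
      rw [lintegral_const_mul'' _ (hΨm i)]
      have h1 : ∫⁻ ω, Ψ i ω ∂P ≤ ENNReal.ofReal (2 ^ (m + 2)) := by
        refine (hΨ i).trans ?_
        rw [ENNReal.ofReal_pow (by norm_num), ENNReal.ofReal_ofNat, ← pow_succ]
        refine pow_le_pow_right₀ (by norm_num) ?_
        have := (unitColumn i).rank_le_width
        omega
      refine (mul_le_mul_right h1 _).trans ?_
      rw [← ENNReal.ofReal_mul (by positivity)]
      refine ENNReal.ofReal_le_ofReal ?_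
      have h2 : Real.exp (-(μ ^ 2 / 2 / a)) ≤ Real.exp (-m) * (n : ℝ)⁻¹ := by
        rw [← hexplog, ← Real.exp_add]
        exact Real.exp_le_exp.2 (by linarith)
      have h3 : (2 : ℝ) ^ m * Real.exp (-m) ≤ 1 := by
        rw [Real.exp_neg, ← div_eq_mul_inv, div_le_one (Real.exp_pos _)]
        exact two_pow_le_exp m
      calc a * Real.exp (-(μ ^ 2 / 2 / a)) * 2 ^ (m + 2)
          ≤ a * (Real.exp (-m) * (n : ℝ)⁻¹) * 2 ^ (m + 2) := by gcongr
        _ = 4 * a * (n : ℝ)⁻¹ * (2 ^ m * Real.exp (-m)) := by ring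
        _ ≤ 4 * a * (n : ℝ)⁻¹ * 1 := by gcongr
        _ = _ := mul_one _
    have hlow : ∀ J : Finset (Fin n),
        ∫⁻ ω, ENNReal.ofReal (a * Real.exp (-((a * D + J.card * (μ ^ 2 / 2)) / a))) * Φ J ω ∂P
          ≤ ENNReal.ofReal (2 * a * (n : ℝ)⁻¹ ^ J.card) := by
      intro J
      rw [lintegral_const_mul'' _ (hΦm J)]
      have h1 : ∫⁻ ω, Φ J ω ∂P ≤ ENNReal.ofReal (2 ^ (D + 1)) := by
        refine (hΦ J).trans ?_
        rw [ENNReal.ofReal_pow (by norm_num), ENNReal.ofReal_ofNat, ← pow_succ]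
        refine pow_le_pow_right₀ (by norm_num) ?_
        rw [hD]
        gcongr
        exact Matrix.rank_mul_le_right _ _
      refine (mul_le_mul_right h1 _).trans ?_
      rw [← ENNReal.ofReal_mul (by positivity)]
      refine ENNReal.ofReal_le_ofReal ?_
      have h2 : Real.exp (-((a * D + J.card * (μ ^ 2 / 2)) / a))
          ≤ Real.exp (-D) * (n : ℝ)⁻¹ ^ J.card := by
        rw [← hexplog, ← Real.exp_nat_mul, ← Real.exp_add]
        refine Real.exp_le_exp.2 ?_
        have h3 : (a * D + J.card * (μ ^ 2 / 2)) / a = D + J.card * L := by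
          rw [hL_def]; field_simp
        rw [h3]
        have h4 : (J.card : ℝ) * Real.log n ≤ J.card * L := by
          gcongr
          linarith [(Nat.cast_nonneg m : (0 : ℝ) ≤ m)]
        linarith
      have h3 : (2 : ℝ) ^ D * Real.exp (-D) ≤ 1 := by
        rw [Real.exp_neg, ← div_eq_mul_inv, div_le_one (Real.exp_pos _)]
        exact two_pow_le_exp D
      calc a * Real.exp (-((a * D + J.card * (μ ^ 2 / 2)) / a)) * 2 ^ (D + 1)
          ≤ a * (Real.exp (-D) * (n : ℝ)⁻¹ ^ J.card) * 2 ^ (D + 1) := by gcongr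
        _ = 2 * a * (n : ℝ)⁻¹ ^ J.card * (2 ^ D * Real.exp (-D)) := by ring
        _ ≤ 2 * a * (n : ℝ)⁻¹ ^ J.card * 1 := by gcongr
        _ = _ := mul_one _
    have hsum1 : ∑ i : Fin n, ENNReal.ofReal (4 * a * (n : ℝ)⁻¹) = ENNReal.ofReal (4 * a) := by
      rw [← ENNReal.ofReal_sum_of_nonneg fun _ _ => by positivity]
      congr 1
      simp
      field_simp
    have hsum2 : ∑ J : Finset (Fin n), ENNReal.ofReal (2 * a * (n : ℝ)⁻¹ ^ J.card)
        ≤ ENNReal.ofReal (6 * a) := by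
      rw [← ENNReal.ofReal_sum_of_nonneg fun _ _ => by positivity, ← Finset.mul_sum]
      refine ENNReal.ofReal_le_ofReal ?_
      nlinarith [sum_inv_pow_card_le hn]
    calc _ ≤ ENNReal.ofReal (a * D) + ENNReal.ofReal (4 * a) + ENNReal.ofReal (6 * a) := by
          refine add_le_add (add_le_add (by simp) ?_) ?_
          · exact (Finset.sum_le_sum fun i _ => hrow i).trans hsum1.le
          · exact (Finset.sum_le_sum fun J _ => hlow J).trans hsum2
      _ ≤ _ := by
          rw [← ENNReal.ofReal_add (by positivity) (by positivity),
            ← ENNReal.ofReal_add (by positivity) (by positivity)]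
          refine ENNReal.ofReal_le_ofReal ?_
          -- Since `(m + q) r ≥ 1`, the remainder `4 a + 6 a` is absorbed: `a (2 d + 10) ≤ 12 a d =
          -- 768 σ² d`.
          have h1 : (1 : ℝ) ≤ ((m : ℝ) + X.rank) * r := by
            have : 1 ≤ (m + X.rank) * r := Nat.mul_pos (by omega) hr
            exact_mod_cast this
          have h2 : (D : ℝ) = 2 * (((m : ℝ) + X.rank) * r) := by
            rw [hD]; push_cast; ring
          rw [h2, ha_def]
          nlinarith [mul_nonneg (sq_nonneg σ) (sub_nonneg.2 h1)]
  · intro ω B C hB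
    obtain ⟨J, hJ⟩ := exists_finset_pairing_sub_penalty_le (E ω) (X * B) C hμ
    have hXB : eraseRows J (X * B) = eraseRows J X * B := by
      simp only [eraseRows, Matrix.mul_assoc]
    rw [hXB] at hJ
    set y := ∑ i, ∑ j, E ω i j * (eraseRows J X * B) i j - ‖eraseRows J X * B‖ ^ 2 / 4
    have hrow : ∀ i, ENNReal.ofReal (‖WithLp.toLp 2 (E ω i)‖ ^ 2 - μ ^ 2 / 2) ≤
        ENNReal.ofReal (a * Real.exp (-(μ ^ 2 / 2 / a))) * Ψ i ω := by
      intro i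
      refine ofReal_sub_le_exp_mul ha ?_
      have := hΨle i ω (Matrix.of fun _ : Fin 1 => (2 : ℝ) • E ω i) (Matrix.rank_le_height _)
      rwa [pairing_unitColumn_sub] at this
    have hlow : ENNReal.ofReal (y - (a * D + J.card * (μ ^ 2 / 2))) ≤ _ :=
      ofReal_sub_le_exp_mul ha (hΦle J ω B hB)
    have hdecomp : ∑ i ∈ J, (‖WithLp.toLp 2 (E ω i)‖ ^ 2 - μ ^ 2) + y =
        a * D + ∑ i ∈ J, (‖WithLp.toLp 2 (E ω i)‖ ^ 2 - μ ^ 2 / 2) +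
          (y - (a * D + J.card * (μ ^ 2 / 2))) := by
      simp only [Finset.sum_sub_distrib, Finset.sum_const, nsmul_eq_mul]
      ring
    refine (ENNReal.ofReal_le_ofReal (hJ.trans hdecomp.le)).trans ?_
    refine ENNReal.ofReal_add_le.trans (add_le_add (ENNReal.ofReal_add_le.trans
      (add_le_add le_rfl ?_)) ?_)
    · calc ENNReal.ofReal (∑ i ∈ J, (‖WithLp.toLp 2 (E ω i)‖ ^ 2 - μ ^ 2 / 2))
          ≤ ∑ i ∈ J, ENNReal.ofReal (‖WithLp.toLp 2 (E ω i)‖ ^ 2 - μ ^ 2 / 2) :=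
            Finset.le_sum_of_subadditive _ ENNReal.ofReal_zero.le
              (fun _ _ => ENNReal.ofReal_add_le) _ _
        _ ≤ ∑ i ∈ J, ENNReal.ofReal (a * Real.exp (-(μ ^ 2 / 2 / a))) * Ψ i ω :=
            Finset.sum_le_sum fun i _ => hrow i
        _ ≤ _ := Finset.sum_le_univ_sum_of_nonneg fun _ => zero_le
    · exact hlow.trans (Finset.single_le_sum (f := fun J : Finset (Fin n) =>
        ENNReal.ofReal (a * Real.exp (-((a * D + J.card * (μ ^ 2 / 2)) / a))) * Φ J ω)
        (fun _ _ => zero_le) (Finset.mem_univ J))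


/-! ### Deterministic error bound and conclusion -/

theorem norm21On_add_compl {n m : ℕ} (A : Matrix (Fin n) (Fin m) ℝ) (J : Finset (Fin n)) :
    norm21On A J + norm21On A Jᶜ = norm21 A := Finset.sum_add_sum_compl J _

theorem norm21_sub_norm21_le {n m : ℕ} (C C' : Matrix (Fin n) (Fin m) ℝ) :
    norm21 C - norm21 C' ≤
      norm21On (C' - C) (rowSupport C) - norm21On (C' - C) (rowSupport C)ᶜ := by
  rw [← norm21On_add_compl C (rowSupport C), ← norm21On_add_compl C' (rowSupport C)]
  have h1 : norm21On C (rowSupport C) ≤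
      norm21On C' (rowSupport C) + norm21On (C' - C) (rowSupport C) := by
    simp only [norm21On, ← Finset.sum_add_distrib]
    refine Finset.sum_le_sum fun i _ => ?_
    rw [show (C' - C) i = C' i - C i from rfl, WithLp.toLp_sub]
    have := norm_sub_norm_le (WithLp.toLp 2 (C i)) (WithLp.toLp 2 (C' i))
    rw [norm_sub_rev] at this
    linarith
  have hzero : ∀ i ∈ (rowSupport C)ᶜ, C i = 0 := by
    intro i hi
    simpa [rowSupport] using hi
  have h2 : norm21On C (rowSupport C)ᶜ = 0 :=
    Finset.sum_eq_zero fun i hi => by simp [hzero i hi]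
  have h3 : norm21On (C' - C) (rowSupport C)ᶜ = norm21On C' (rowSupport C)ᶜ :=
    Finset.sum_congr rfl fun i hi => by
      rw [show (C' - C) i = C' i - C i from rfl, hzero i hi, sub_zero]
  linarith

theorem norm_sub_sq_matrix {n m : ℕ} (W D : Matrix (Fin n) (Fin m) ℝ) :
    ‖W - D‖ ^ 2 = ‖W‖ ^ 2 - 2 * ∑ i, ∑ j, W i j * D i j + ‖D‖ ^ 2 := by
  simp only [frobenius_sq, Finset.mul_sum, ← Finset.sum_sub_distrib, ← Finset.sum_add_distrib]
  refine Finset.sum_congr rfl fun i _ => Finset.sum_congr rfl fun j _ => ?_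
  rw [Matrix.sub_apply]
  ring

/-- Comparison of the criterion at the estimate and at the truth. -/
theorem IsEstimate.basic_inequality {n p m r : ℕ} {X : Matrix (Fin n) (Fin p) ℝ}
    {Bstar B : Matrix (Fin p) (Fin m) ℝ} {Cstar W C : Matrix (Fin n) (Fin m) ℝ} {lam : ℝ}
    (h : IsEstimate X (X * Bstar + Cstar + W) lam r B C) (hrank : Bstar.rank ≤ r)
    (hlam : 0 ≤ lam) :
    ‖X * (B - Bstar) + (C - Cstar)‖ ^ 2 / 2 + lam * norm21On (C - Cstar) (rowSupport Cstar)ᶜ ≤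
      ∑ i, ∑ j, W i j * (X * (B - Bstar) + (C - Cstar)) i j
        + lam * norm21On (C - Cstar) (rowSupport Cstar) := by
  have h1 := h.2 Bstar Cstar hrank
  simp only [criterion] at h1
  rw [show X * Bstar + Cstar + W - X * B - C = W - (X * (B - Bstar) + (C - Cstar)) by
      rw [Matrix.mul_sub]; abel,
    show X * Bstar + Cstar + W - X * Bstar - Cstar = W by abel, norm_sub_sq_matrix] at h1
  have h2 := mul_le_mul_of_nonneg_left (norm21_sub_norm21_le Cstar C) hlam
  linarith

theorem IsEstimate.error_bound {n p m r : ℕ} {X : Matrix (Fin n) (Fin p) ℝ}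
    {Bstar B : Matrix (Fin p) (Fin m) ℝ} {Cstar W C : Matrix (Fin n) (Fin m) ℝ}
    {lam σ ϑ ζ δ : ℝ} (hϑ : 0 < ϑ) (hδ : δ = ϑ / (2 * (1 + ϑ)))
    (h : IsEstimate X (X * Bstar + Cstar + W) lam r B C) (hrank : Bstar.rank ≤ r)
    (hlam : 0 ≤ lam) (hσ : 0 ≤ σ) (hζ : 0 ≤ ζ)
    (hreg : RegularAt X (rowSupport Cstar) r lam σ ϑ ζ (B - Bstar) (C - Cstar)) :
    n * ‖B - Bstar‖ ^ 2 ≤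
      2 * (∑ i, ∑ j, W i j * (X * (B - Bstar) + (C - Cstar)) i j
        - ‖X * (B - Bstar) + (C - Cstar)‖ ^ 2 / 4 - δ * lam * norm21 (C - Cstar))
      + 2 * (σ ^ 2 * ζ ^ 2 * (((m : ℝ) + X.rank) * r)) := by
  have hbasic := h.basic_inequality hrank hlam
  unfold RegularAt at hreg
  have hadd := norm21On_add_compl (C - Cstar) (rowSupport Cstar)
  set D := ‖X * (B - Bstar) + (C - Cstar)‖
  set u := norm21On (C - Cstar) (rowSupport Cstar)
  set v := norm21On (C - Cstar) (rowSupport Cstar)ᶜ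
  have hu : 0 ≤ u := Finset.sum_nonneg fun _ _ => norm_nonneg _
  have hD : 0 ≤ D := norm_nonneg _
  set w := Real.sqrt (((m : ℝ) + X.rank) * r)
  have hw0 : 0 ≤ w := Real.sqrt_nonneg _
  have hw : w ^ 2 = ((m : ℝ) + X.rank) * r := Real.sq_sqrt (by positivity)
  rw [← hw, ← hadd]
  have hδϑ : δ * (1 + ϑ) = ϑ / 2 := by rw [hδ]; field_simp
  have hδ0 : 0 ≤ δ := by rw [hδ]; positivity
  have hδ1 : δ ≤ 1 / 2 := by nlinarith
  have hδ2 : δ ≤ ϑ / 2 := by nlinarith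
  have h1 := mul_le_mul_of_nonneg_left hreg (show 0 ≤ 1 - δ by linarith)
  have h2 : (1 - δ) * (σ * ζ * w * D) ≤ σ * ζ * w * D := by
    have : 0 ≤ σ * ζ * w * D := by positivity
    nlinarith
  have h3 : σ * ζ * w * D ≤ D ^ 2 / 4 + σ ^ 2 * ζ ^ 2 * w ^ 2 := by
    nlinarith [sq_nonneg (D / 2 - σ * ζ * w)]
  have h4 : δ * (lam * u) ≤ ϑ / 2 * (lam * u) := by gcongr
  -- Here `δ` is chosen so that `(1 - δ) (1 + ϑ) = 1 + ϑ / 2`: after adding the basic inequality, `ϑ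
  -- / 2 ≥ δ` remains on the support and `δ` off it.
  have h5 : (1 - δ) * ((1 + ϑ) * lam * u) = (1 + ϑ / 2) * (lam * u) := by
    linear_combination (-(lam * u)) * hδϑ
  have h6 : n * ‖B - Bstar‖ ^ 2 / 2 ≤ (1 - δ) * (n * ‖B - Bstar‖ ^ 2) := by
    have : 0 ≤ n * ‖B - Bstar‖ ^ 2 := by positivity
    nlinarith
  rw [mul_add, h5, mul_add] at h1
  linarith

/-- The constant 12 suffices because `12² = 144 ≥ 128`. -/
theorem tuning_threshold {n m : ℕ} {A σ δ : ℝ} (hδ : 0 < δ) (hA : 12 / δ ≤ A)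
    (hσ : 0 < σ) :
    0 ≤ tuning n m A σ ∧ 128 * σ ^ 2 * (m + Real.log n) ≤ (δ * tuning n m A σ) ^ 2 := by
  have hL : 0 ≤ (m : ℝ) + Real.log n := add_nonneg (Nat.cast_nonneg m) (Real.log_natCast_nonneg n)
  have hA0 : 0 < A := lt_of_lt_of_le (by positivity) hA
  have h12 : 12 ≤ δ * A := by rw [div_le_iff₀ hδ] at hA; linarith
  refine ⟨by unfold tuning; positivity, ?_⟩
  have h1 : (δ * tuning n m A σ) ^ 2 = (δ * A) ^ 2 * (σ ^ 2 * (m + Real.log n)) := by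
    have := Real.sq_sqrt hL
    unfold tuning
    calc _ = (δ * A) ^ 2 * (σ ^ 2 * √(m + Real.log n) ^ 2) := by ring
      _ = _ := by rw [this]
  rw [h1, mul_assoc]
  gcongr
  nlinarith

end RobustRRR

theorem theorem10 (ϑ : ℝ) (hϑ : 0 < ϑ) :
    -- thresholds and constants depend on `ϑ` only
    ∃ A₀ : ℝ, 0 < A₀ ∧ ∃ c : ℝ, 0 < c ∧ ∀ A : ℝ, A₀ ≤ A →
      ∀ (n p m r : ℕ) (X : Matrix (Fin n) (Fin p) ℝ)
        (Bstar : Matrix (Fin p) (Fin m) ℝ) (Cstar : Matrix (Fin n) (Fin m) ℝ) (σ ζ : ℝ),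
        0 < n → 1 ≤ Bstar.rank → Bstar.rank ≤ r → 0 < σ → 0 ≤ ζ →
      ∀ {Ω : Type*} [MeasurableSpace Ω] (P : Measure Ω) [IsProbabilityMeasure P]
        (E : Ω → Matrix (Fin n) (Fin m) ℝ), RobustRRR.IsSubGaussianNoise P E σ →
      -- any (measurable) choice of global minimizers for the data `Y = X B* + C* + E`
      ∀ (Bhat : Ω → Matrix (Fin p) (Fin m) ℝ) (Chat : Ω → Matrix (Fin n) (Fin m) ℝ),
        (∀ i j, AEMeasurable (fun ω => Bhat ω i j) P) →
        (∀ i j, AEMeasurable (fun ω => Chat ω i j) P) →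
        (∀ᵐ ω ∂P, RobustRRR.IsEstimate X (X * Bstar + Cstar + E ω)
          (RobustRRR.tuning n m A σ) r (Bhat ω) (Chat ω)) →
      -- the regularity condition, for all pairs in a prescribed set `S` (possibly all pairs)
      ∀ S : Set (Matrix (Fin p) (Fin m) ℝ × Matrix (Fin n) (Fin m) ℝ),
        (∀ B' C', (B', C') ∈ S → B'.rank ≤ 2 * r →
          RobustRRR.RegularAt X (RobustRRR.rowSupport Cstar) r
            (RobustRRR.tuning n m A σ) σ ϑ ζ B' C') →
        NullMeasurableSet {ω | (Bhat ω - Bstar, Chat ω - Cstar) ∈ S} P →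
      -- risk bound on the event that the error lies in `S`
      (IntegrableOn (fun ω => ‖Bhat ω - Bstar‖ ^ 2)
          {ω | (Bhat ω - Bstar, Chat ω - Cstar) ∈ S} P ∧
        ∫ ω in {ω | (Bhat ω - Bstar, Chat ω - Cstar) ∈ S}, ‖Bhat ω - Bstar‖ ^ 2 ∂P
          ≤ c * (σ ^ 2 * (1 + ζ ^ 2) * (((m : ℝ) + X.rank) * r / n))) ∧
      -- risk bound when the error lies in `S` almost surely
      ((∀ᵐ ω ∂P, (Bhat ω - Bstar, Chat ω - Cstar) ∈ S) →
        Integrable (fun ω => ‖Bhat ω - Bstar‖ ^ 2) P ∧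
        ∫ ω, ‖Bhat ω - Bstar‖ ^ 2 ∂P
          ≤ c * (σ ^ 2 * (1 + ζ ^ 2) * (((m : ℝ) + X.rank) * r / n))) := by
  set δ : ℝ := ϑ / (2 * (1 + ϑ)) with hδ
  have hδ0 : 0 < δ := by positivity
  -- The value `1536 = 2 · 768` comes from the noise term; the `ζ²` term only needs the constant 2.
  refine ⟨12 / δ, by positivity, 1536, by norm_num, ?_⟩
  intro A hA n p m r X Bstar Cstar σ ζ hn hr1 hrr hσ hζ Ω _ P _ E hE Bhat Chat hBm _ hest S hreg hS
  set lam := RobustRRR.tuning n m A σ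
  obtain ⟨hlam, hthr⟩ := RobustRRR.tuning_threshold (n := n) (m := m) hδ0 hA hσ
  have hm : 0 < m := lt_of_lt_of_le hr1 (Matrix.rank_le_width Bstar)
  obtain ⟨R, hRm, hR, hRle⟩ := hE.exists_compensated_bound hn hm (hr1.trans hrr) hσ X
    (mul_nonneg hδ0.le hlam) hthr
  have hn' : (0 : ℝ) < n := by exact_mod_cast hn
  set T := {ω | (Bhat ω - Bstar, Chat ω - Cstar) ∈ S}
  set d : ℝ := ((m : ℝ) + X.rank) * r
  have hd : 0 ≤ d := by positivity
  set b : ℝ := 1536 * (σ ^ 2 * (1 + ζ ^ 2) * (d / n)) with hb_def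
  have hb : 0 ≤ b := by positivity
  have hmeas : AEMeasurable (fun ω => ‖Bhat ω - Bstar‖ ^ 2) P := by
    simp only [RobustRRR.frobenius_sq, Matrix.sub_apply]
    exact Finset.aemeasurable_fun_sum _ fun i _ => Finset.aemeasurable_fun_sum _ fun j _ =>
      ((hBm i j).sub_const _).pow_const 2
  have hpt : ∀ᵐ ω ∂P.restrict T, ENNReal.ofReal (‖Bhat ω - Bstar‖ ^ 2) ≤
      ENNReal.ofReal (2 / n) * R ω + ENNReal.ofReal (2 / n * (σ ^ 2 * ζ ^ 2 * d)) := by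
    filter_upwards [ae_restrict_mem₀ hS, ae_restrict_of_ae hest] with ω hω hωest
    have hrank : (Bhat ω - Bstar).rank ≤ 2 * r := by
      have := RobustRRR.rank_sub_le (Bhat ω) Bstar
      have := hωest.1
      omega
    have h1 := hωest.error_bound hϑ hδ hrr hlam hσ.le hζ (hreg _ _ hω hrank)
    have h2 := hRle ω (Bhat ω - Bstar) (Chat ω - Cstar) hrank
    refine le_trans ?_ (add_le_add_left (mul_le_mul_right h2 _) _)
    rw [← ENNReal.ofReal_mul (by positivity)]
    refine le_trans (ENNReal.ofReal_le_ofReal ?_) ENNReal.ofReal_add_le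
    refine le_of_mul_le_mul_left (h1.trans (le_of_eq ?_)) hn'
    field_simp
    ring
  have hlint : ∫⁻ ω in T, ENNReal.ofReal (‖Bhat ω - Bstar‖ ^ 2) ∂P ≤ ENNReal.ofReal b := by
    calc ∫⁻ ω in T, ENNReal.ofReal (‖Bhat ω - Bstar‖ ^ 2) ∂P
        ≤ ∫⁻ ω in T, (ENNReal.ofReal (2 / n) * R ω +
            ENNReal.ofReal (2 / n * (σ ^ 2 * ζ ^ 2 * d))) ∂P := lintegral_mono_ae hpt
      _ ≤ ∫⁻ ω, (ENNReal.ofReal (2 / n) * R ω +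
            ENNReal.ofReal (2 / n * (σ ^ 2 * ζ ^ 2 * d))) ∂P := setLIntegral_le_lintegral _ _
      _ = ENNReal.ofReal (2 / n) * ∫⁻ ω, R ω ∂P +
            ENNReal.ofReal (2 / n * (σ ^ 2 * ζ ^ 2 * d)) := by
          rw [lintegral_add_right _ measurable_const, lintegral_const_mul'' _ hRm]
          simp
      _ ≤ ENNReal.ofReal (2 / n) * ENNReal.ofReal (768 * (σ ^ 2 * d)) +
            ENNReal.ofReal (2 / n * (σ ^ 2 * ζ ^ 2 * d)) := by gcongr
      _ ≤ ENNReal.ofReal b := by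
          rw [← ENNReal.ofReal_mul (by positivity),
            ← ENNReal.ofReal_add (by positivity) (by positivity)]
          refine ENNReal.ofReal_le_ofReal ?_
          have h1 : 0 ≤ σ ^ 2 * ζ ^ 2 * (d / n) := by positivity
          have h2 : 2 / n * (768 * (σ ^ 2 * d)) + 2 / n * (σ ^ 2 * ζ ^ 2 * d) =
              1536 * (σ ^ 2 * (d / n)) + 2 * (σ ^ 2 * ζ ^ 2 * (d / n)) := by ring
          rw [h2, hb_def]
          linarith
  have hnn : ∀ μ : Measure Ω, 0 ≤ᵐ[μ] fun ω => ‖Bhat ω - Bstar‖ ^ 2 := fun _ =>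
    Filter.Eventually.of_forall fun _ => sq_nonneg _
  have hint : IntegrableOn (fun ω => ‖Bhat ω - Bstar‖ ^ 2) T P := by
    refine ⟨hmeas.aestronglyMeasurable.restrict, ?_⟩
    rw [hasFiniteIntegral_iff_ofReal (hnn _)]
    exact hlint.trans_lt ENNReal.ofReal_lt_top
  have hbound : ∫ ω in T, ‖Bhat ω - Bstar‖ ^ 2 ∂P ≤ b := by
    rw [integral_eq_lintegral_of_nonneg_ae (hnn _) hint.1]
    exact ENNReal.toReal_le_of_le_ofReal hb hlint
  refine ⟨⟨hint, hbound⟩, fun hall => ?_⟩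
  have hrestr : P.restrict T = P := Measure.restrict_eq_self_of_ae_mem hall
  rw [IntegrableOn, hrestr] at hint
  rw [hrestr] at hbound
  exact ⟨hint, hbound⟩
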